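/- Let $\mathcal H=(C,F,D,G)$ be a hybrid inclusion on $\mathbb R^n$: $\dot x\in F(x)$ for $x\in C$ and $x^+\in G(x)$ for $x\in D$, with $C,D\subset\mathbb R^n$ and set-valued maps $F,G:\mathbb R^n\rightrightarrows\mathbb R^n$. Solutions $(t,j)\mapsto x(t,j)$ are defined on hybrid time domains $\operatorname{dom}x\subset\mathbb R_{\ge0}\times\mathbb N$; for each $j$, $t\mapsto x(t,j)$ is (locally) absolutely continuous on $I^j=\{t:(t,j)\in\operatorname{dom}x\}$; $x(0,0)\in\operatorname{cl}(C)\cup D$; whenever $I^j$ has nonempty interior, $x(t,j)\in C$ for all $t\in\operatorname{int}I^j$ and $\dot x(t,j)\in F(x(t,j))$ for almost all $t\in I^j$; and $x(t,j)\in D$, $x(t,j+1)\in G(x(t,j))$ whenever $(t,j),(t,j+1)\in\operatorname{dom}x$. Assume that on $C$ the map $F$ is outer semicontinuous and locally bounded (relative to $C$) with nonempty convex values, and that $G(x)\neq\emptyset$ for all $x\in D$. Let $B:\mathbb R^n\to\mathbb R$ be locally Lipschitz, $K_e:=\{x\in\mathbb R^n: B(x)\le 0\}$, and let $K:=\{x\in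 C\cup D: B(x)\le 0\}$ be closed. Assume that every $p\in\partial K$ from which a solution can flow (that is, there is a solution $x$ with $x(0,0)=p$ and $(t,0)\in\operatorname{dom}x$ for some $t>0$) belongs to $C$; this is automatic when $C$ is closed. Write $T_S(x)=\{v:\liminf_{h\to0^+}\operatorname{dist}(x+hv,S)/h=0\}$ for the contingent cone, and let $\partial_C B(x)$ be the Clarke generalized gradient, i.e. the convex hull of all limits $\lim_i\nabla B(x_i)$ with $x_i\to x$, $B$ differentiable at each $x_i$ and $x_i\notin\Omega$, where $\Omega$ is an arbitrary fixed Lebesgue-null set. Suppose that \begin{align*} &\max_{\zeta\in\partial_C B(x)}\langle\zeta,\eta\rangle<0 && \forall x\in K_e\cap C,\ \forall\eta\in F(x)\cap T_C(x),\\ &F(x)\cap T_{\partial C\cap\partial K}(x)=\emptyset && \forall x\in\partial K\cap\partial C,\\ &B(\eta)<0 && \forall x\in K\cap D,\ \forall\eta\in G(x),\\ &G(x)\subset C\cup D && \forall x\in K\cap D,\\ &G(x)\subset\operatorname{int}(C\cup D) && \forall x\in\partial K\cap D. \end{align*} Then $K$ is pre-contractive for $\mathcal H$: every maximal solution starting in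 $K$ stays in $K$ on its whole domain, and for every nontrivial solution $x$ (one whose domain has at least two points) with $x(0,0)\in\partial K$ there are $T>0$ and $J\in\{1,2,\dots,\infty\}$ such that $x(t,j)\in\operatorname{int}(K)$ for all $(t,j)\in\operatorname{dom}x\cap\big[([0,T]\times\{0\})\cup(\{0\}\times\{0,1,\dots,J\})\big]$ with $(t,j)\ne(0,0)$. -/

import Mathlib

open Set Filter Topology MeasureTheory

/-! ### Hybrid inclusions and their solutions -/

/-- The data `(C, F, D, G)` of a hybrid inclusion on `ℝⁿ`:
`ẋ ∈ F(x)` while `x ∈ C`, and `x⁺ ∈ G(x)` when `x ∈ D`. -/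
structure HybridSystem (n : ℕ) where
  /-- the flow set -/
  C : Set (EuclideanSpace ℝ (Fin n))
  /-- the flow map -/
  F : EuclideanSpace ℝ (Fin n) → Set (EuclideanSpace ℝ (Fin n))
  /-- the jump set -/
  D : Set (EuclideanSpace ℝ (Fin n))
  /-- the jump map -/
  G : EuclideanSpace ℝ (Fin n) → Set (EuclideanSpace ℝ (Fin n))

/-- A (nonempty) hybrid time domain: a subset of `[0, ∞) × ℕ` such that, for each of its points
`(T, J)`, its truncation to `[0, T] × {0, …, J}` is `⋃_{j ≤ J} [t_j, t_{j+1}] × {j}` for some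
`0 = t_0 ≤ t_1 ≤ … ≤ t_{J+1}`. -/
def IsHybridTimeDomain (E : Set (ℝ × ℕ)) : Prop :=
  E.Nonempty ∧ (∀ p ∈ E, 0 ≤ p.1) ∧
    ∀ T : ℝ, ∀ J : ℕ, (T, J) ∈ E →
      ∃ t : ℕ → ℝ, t 0 = 0 ∧ (∀ j ≤ J, t j ≤ t (j + 1)) ∧
        E ∩ (Icc 0 T ×ˢ Iic J) = ⋃ j ∈ Iic J, Icc (t j) (t (j + 1)) ×ˢ {j}

/-- A function defined on a set `dom ⊆ ℝ × ℕ` of hybrid times. The values of `toFun` outside `dom`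
are irrelevant. -/
structure HybridArc (n : ℕ) where
  /-- the domain -/
  dom : Set (ℝ × ℕ)
  /-- the values -/
  toFun : ℝ → ℕ → EuclideanSpace ℝ (Fin n)

namespace HybridArc

variable {n : ℕ}

/-- The interval `Iʲ = {t | (t, j) ∈ dom x}`. -/
def interval (x : HybridArc n) (j : ℕ) : Set ℝ := {t | (t, j) ∈ x.dom}

/-- `x` is a solution to the hybrid system `H`. -/
structure IsSolution (H : HybridSystem n) (x : HybridArc n) : Prop where
  hybridTimeDomain : IsHybridTimeDomain x.dom
  /-- `t ↦ x(t, j)` is absolutely continuous on every compact subinterval of `Iʲ` -/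
  absolutelyContinuous : ∀ j : ℕ, ∀ a ∈ x.interval j, ∀ b ∈ x.interval j,
    AbsolutelyContinuousOnInterval (fun t => x.toFun t j) a b
  init : x.toFun 0 0 ∈ closure H.C ∪ H.D
  flow_mem : ∀ j : ℕ, (interior (x.interval j)).Nonempty →
    ∀ t ∈ interior (x.interval j), x.toFun t j ∈ H.C
  flow : ∀ j : ℕ, (interior (x.interval j)).Nonempty →
    ∀ᵐ t ∂(volume.restrict (x.interval j)),
      ∃ v ∈ H.F (x.toFun t j), HasDerivAt (fun s => x.toFun s j) v t
  jump : ∀ t : ℝ, ∀ j : ℕ, (t, j) ∈ x.dom → (t, j + 1) ∈ x.dom →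
    x.toFun t j ∈ H.D ∧ x.toFun t (j + 1) ∈ H.G (x.toFun t j)

/-- A solution is maximal if no solution properly extends it. -/
def IsMaximalSolution (H : HybridSystem n) (x : HybridArc n) : Prop :=
  x.IsSolution H ∧
    ¬ ∃ y : HybridArc n, y.IsSolution H ∧ x.dom ⊂ y.dom ∧
      ∀ t : ℝ, ∀ j : ℕ, (t, j) ∈ x.dom → x.toFun t j = y.toFun t j

end HybridArc

namespace HybridSystem

variable {n : ℕ}

/-- There is a solution starting from `p` that flows initially, that is, whose domain contains
`(t, 0)` for some `t > 0`. -/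
def CanFlowFrom (H : HybridSystem n) (p : EuclideanSpace ℝ (Fin n)) : Prop :=
  ∃ x : HybridArc n, x.IsSolution H ∧ x.toFun 0 0 = p ∧ ∃ t : ℝ, 0 < t ∧ (t, 0) ∈ x.dom

/-- The set `K` is forward pre-invariant for `H`. -/
def ForwardPreInvariant (H : HybridSystem n) (K : Set (EuclideanSpace ℝ (Fin n))) : Prop :=
  ∀ x : HybridArc n, x.IsMaximalSolution H → x.toFun 0 0 ∈ K →
    ∀ t : ℝ, ∀ j : ℕ, (t, j) ∈ x.dom → x.toFun t j ∈ K

/-- The (closed) set `K` is pre-contractive for `H`: it is forward pre-invariant, and every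
nontrivial solution starting from its boundary is immediately in its interior. Here `J` ranges over
`{1, 2, …, ∞}`. -/
def PreContractive (H : HybridSystem n) (K : Set (EuclideanSpace ℝ (Fin n))) : Prop :=
  H.ForwardPreInvariant K ∧
    ∀ x : HybridArc n, x.IsSolution H → x.dom.Nontrivial → x.toFun 0 0 ∈ frontier K →
      ∃ T : ℝ, 0 < T ∧ ∃ J : ℕ∞, 1 ≤ J ∧
        ∀ t : ℝ, ∀ j : ℕ, (t, j) ∈ x.dom →
          (t ∈ Icc 0 T ∧ j = 0 ∨ t = 0 ∧ (j : ℕ∞) ≤ J) → (t, j) ≠ (0, 0) →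
            x.toFun t j ∈ interior K

/-- The standing assumptions: on `C` (and relative to `C`) the flow map is outer semicontinuous and
locally bounded with nonempty convex images, and `G` has nonempty images on `D`. -/
structure StandingAssumptions (H : HybridSystem n) : Prop where
  outerSemicontinuous : ∀ p ∈ H.C, ∀ u y : ℕ → EuclideanSpace ℝ (Fin n),
    ∀ η : EuclideanSpace ℝ (Fin n), (∀ k, u k ∈ H.C) → (∀ k, y k ∈ H.F (u k)) →
      Tendsto u atTop (𝓝 p) → Tendsto y atTop (𝓝 η) → η ∈ H.F p
  locallyBounded : ∀ p ∈ H.C, ∃ U ∈ 𝓝 p, ∃ M : ℝ, ∀ q ∈ U ∩ H.C, ∀ η ∈ H.F q, ‖η‖ ≤ M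
  nonempty : ∀ p ∈ H.C, (H.F p).Nonempty
  convex : ∀ p ∈ H.C, Convex ℝ (H.F p)
  jump_nonempty : ∀ p ∈ H.D, (H.G p).Nonempty

/-- The set `K = {x ∈ C ∪ D | B(x) ≤ 0}` defined by the scalar barrier function candidate `B`. -/
def barrierSet (H : HybridSystem n) (B : EuclideanSpace ℝ (Fin n) → ℝ) :
    Set (EuclideanSpace ℝ (Fin n)) :=
  {p | p ∈ H.C ∪ H.D ∧ B p ≤ 0}

end HybridSystem

/-! ### Cones and generalized gradients -/

/-- The contingent cone `T_S(p) = {v | liminf_{h → 0⁺} dist(p + h v, S) / h = 0}`. The quotient is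
taken in `[0, ∞]`, so no boundedness is needed for the `liminf`, and the distance to the empty set
is `∞`. -/
noncomputable def contingentCone {n : ℕ} (S : Set (EuclideanSpace ℝ (Fin n)))
    (p : EuclideanSpace ℝ (Fin n)) : Set (EuclideanSpace ℝ (Fin n)) :=
  {v | liminf (fun h : ℝ => Metric.infEDist (p + h • v) S / ENNReal.ofReal h) (𝓝[>] 0) = 0}

/-- The Clarke generalized gradient `∂_C B(p)` of a locally Lipschitz function `B`: the convex hull
of the limits of gradients `∇B(u_k)` along sequences `u_k → p` of points of differentiability that
avoid the (arbitrary) null set `Ω`. -/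
noncomputable def clarkeGradient {n : ℕ} (Ω : Set (EuclideanSpace ℝ (Fin n)))
    (B : EuclideanSpace ℝ (Fin n) → ℝ) (p : EuclideanSpace ℝ (Fin n)) :
    Set (EuclideanSpace ℝ (Fin n)) :=
  convexHull ℝ {ζ | ∃ u : ℕ → EuclideanSpace ℝ (Fin n),
    Tendsto u atTop (𝓝 p) ∧ (∀ k, DifferentiableAt ℝ B (u k)) ∧ (∀ k, u k ∉ Ω) ∧
      Tendsto (fun k => gradient B (u k)) atTop (𝓝 ζ)}

/-! Everything is infinitesimal at the start `p` of a flow arc with `p ∈ C`. Near `p` the velocities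
stay close to the compact convex set `F p`, so by the mean value inclusion the difference quotients
do too; along any sequence of times they cluster at some `η ∈ F p`, and `η ∈ T_C(p)` because the arc
runs in `C` (`exists_mem_contingentCone`).

If `B` failed to decrease at arbitrarily small times, such an `η` would contradict the Clarke
condition (`eventually_barrier_lt`). Hence `B < 0` just after a start in `K`, and the arc can miss
`int K` only by lying on `∂C ∩ ∂K`. If it did so at arbitrarily small times, `η` would be tangent to
that set, which is excluded (`eventually_mem_interior`).

Invariance follows by continuous induction along flows and induction over jumps. The conditions on
`G` handle the jumps directly. -/

/-! ### Absolutely continuous functions -/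

/-- Postcomposition with a Lipschitz function preserves absolute continuity. -/
theorem LipschitzWith.comp_absolutelyContinuousOnInterval {X Y : Type*} [PseudoMetricSpace X]
    [PseudoMetricSpace Y] {L : NNReal} {g : X → Y} (hg : LipschitzWith L g) {f : ℝ → X} {a b : ℝ}
    (hf : AbsolutelyContinuousOnInterval f a b) :
    AbsolutelyContinuousOnInterval (fun t => g (f t)) a b := by
  unfold AbsolutelyContinuousOnInterval at hf ⊢
  have h := hf.const_mul (L : ℝ)
  rw [mul_zero] at h
  refine squeeze_zero (fun E => Finset.sum_nonneg fun i _ => dist_nonneg) (fun E => ?_) h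
  rw [Finset.mul_sum]
  exact Finset.sum_le_sum fun i _ => hg.dist_le_mul _ _

/-- An absolutely continuous function grows at most as fast as an a.e. bound on its derivative. -/
theorem AbsolutelyContinuousOnInterval.sub_le_of_ae_deriv_le {f : ℝ → ℝ} {a b c : ℝ} (hab : a ≤ b)
    (hf : AbsolutelyContinuousOnInterval f a b)
    (h : ∀ᵐ t, t ∈ Ioo a b → deriv f t ≤ c) : f b - f a ≤ c * (b - a) := by
  rw [← hf.integral_deriv_eq_sub]
  have hc : ∫ _ in a..b, c = c * (b - a) := by simp [mul_comm]
  rw [← hc]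
  refine intervalIntegral.integral_mono_ae_restrict hab hf.intervalIntegrable_deriv
    intervalIntegrable_const ?_
  rw [EventuallyLE, ← restrict_Ioo_eq_restrict_Icc, ae_restrict_iff' measurableSet_Ioo]
  exact h

/-- **Mean value inclusion**: if the derivative of an absolutely continuous curve is almost
everywhere in a closed convex set, so are its difference quotients. -/
theorem AbsolutelyContinuousOnInterval.slope_mem {E : Type*} [NormedAddCommGroup E]
    [NormedSpace ℝ E] {f : ℝ → E} {a b : ℝ} (hab : a < b)
    (hf : AbsolutelyContinuousOnInterval f a b) {A : Set E} (hA : Convex ℝ A) (hAc : IsClosed A)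
    (h : ∀ᵐ t, t ∈ Ioo a b → ∃ v ∈ A, HasDerivAt f v t) : slope f a b ∈ A := by
  by_contra hn
  -- A functional `g` separates the slope from `A` at level `u`: `g ∘ f` has derivative at most `u`
  -- almost everywhere, yet its mean slope would exceed `u`.
  obtain ⟨g, u, hg, hu⟩ := geometric_hahn_banach_closed_point hA hAc hn
  have hac := g.lipschitz.comp_absolutelyContinuousOnInterval hf
  have hle := hac.sub_le_of_ae_deriv_le (c := u) hab.le (by
    filter_upwards [h] with t ht hmem
    obtain ⟨v, hv, hd⟩ := ht hmem
    exact (g.hasFDerivAt.comp_hasDerivAt t hd).deriv.trans_le (hg v hv).le)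
  rw [← map_sub] at hle
  rw [slope_def_module, map_smul, smul_eq_mul, lt_inv_mul_iff₀ (sub_pos.2 hab)] at hu
  linarith [mul_comm u (b - a)]

/-! ### Clarke generalized gradients -/

section Clarke

variable {n : ℕ}

local notation "E" => EuclideanSpace ℝ (Fin n)

/-- If all Clarke gradients at `p` have inner product less than `c` with `η`, so do all gradients at
nearby points of differentiability outside `Ω`. -/
theorem eventually_inner_gradient_lt {B : E → ℝ} (hB : LocallyLipschitz B) {Ω : Set E} {p η : E}
    {c : ℝ} (h : ∀ ζ ∈ clarkeGradient Ω B p, inner ℝ ζ η < c) :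
    ∀ᶠ y in 𝓝 p, DifferentiableAt ℝ B y → y ∉ Ω → inner ℝ (gradient B y) η < c := by
  by_contra hn
  obtain ⟨u, hu, hun⟩ := exists_seq_forall_of_frequently (not_eventually.1 hn)
  push Not at hun
  -- The local Lipschitz constant bounds the gradients at the bad points, so a subsequence converges
  -- to a Clarke gradient violating `h`.
  obtain ⟨L, s, hs, hL⟩ := hB p
  have hb : ∀ᶠ k in atTop, gradient B (u k) ∈ Metric.closedBall (0 : E) L := by
    filter_upwards [hu.eventually (eventually_mem_nhds_iff.2 hs)] with k hk
    rw [mem_closedBall_zero_iff, gradient, LinearIsometryEquiv.norm_map]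
    exact norm_fderiv_le_of_lipschitzOn ℝ hk hL
  obtain ⟨ζ, -, φ, hφ, hlim⟩ :=
    (isCompact_closedBall (0 : E) (L : ℝ)).tendsto_subseq' hb.frequently
  have hmem : ζ ∈ clarkeGradient Ω B p :=
    subset_convexHull ℝ _ ⟨u ∘ φ, hu.comp hφ.tendsto_atTop, fun k => (hun (φ k)).1,
      fun k => (hun (φ k)).2.1, hlim⟩
  refine (h ζ hmem).not_ge ?_
  exact ge_of_tendsto (hlim.inner tendsto_const_nhds)
    (Eventually.of_forall fun k => (hun (φ k)).2.2)

/-- A full-measure set contains almost all of almost every line of a given direction. -/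
theorem ae_ae_add_smul_of_ae {P : E → Prop} (hP : ∀ᵐ y, P y) (η : E) :
    ∀ᵐ y : E, ∀ᵐ s : ℝ, P (y + s • η) := by
  -- Swapping the two quantifiers needs a measurable exceptional set; for fixed `s`, translation by
  -- `s • η` preserves null sets.
  obtain ⟨t, hPt, htm, ht0⟩ := exists_measurable_superset_of_null (ae_iff.1 hP)
  have hmeas : MeasurableSet {x : E × ℝ | x.1 + x.2 • η ∉ t} :=
    (by fun_prop : Measurable fun x : E × ℝ => x.1 + x.2 • η) htm.compl
  have key : ∀ᵐ y : E, ∀ᵐ s : ℝ, y + s • η ∉ t := by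
    rw [Measure.ae_ae_comm hmeas]
    refine Eventually.of_forall fun s => ?_
    have := (measurePreserving_add_right (volume : Measure E) (s • η)).quasiMeasurePreserving
    exact this.ae (measure_eq_zero_iff_ae_notMem.1 ht0)
  filter_upwards [key] with y hy
  filter_upwards [hy] with s hs
  by_contra hn
  exact hs (hPt hn)

/-- Clarke gradients at `p` bound the difference quotients of `B` near `p`. -/
theorem exists_ball_sub_le_of_clarkeGradient {B : E → ℝ} (hB : LocallyLipschitz B) {Ω : Set E}
    (hΩ : volume Ω = 0) {p η : E} {c : ℝ} (h : ∀ ζ ∈ clarkeGradient Ω B p, inner ℝ ζ η < c) :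
    ∃ r > 0, ∀ y ∈ Metric.ball p r, ∀ t : ℝ, 0 ≤ t → y + t • η ∈ Metric.ball p r →
      B (y + t • η) - B y ≤ c * t := by
  obtain ⟨L, s, hs, hL⟩ := hB p
  obtain ⟨r, hr, hball⟩ := Metric.mem_nhds_iff.1
    (inter_mem hs (eventually_inner_gradient_lt hB h))
  refine ⟨r, hr, ?_⟩
  set U := Metric.ball p r with hU
  have hLU : LipschitzOnWith L B U := hL.mono fun y hy => (hball hy).1
  have hae : ∀ᵐ y : E, y ∈ U → DifferentiableAt ℝ B y ∧ inner ℝ (gradient B y) η < c := by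
    filter_upwards [hLU.ae_differentiableWithinAt_of_mem (μ := volume),
      measure_eq_zero_iff_ae_notMem.1 hΩ] with y hy hyΩ hyU
    have hd := (hy hyU).differentiableAt (Metric.isOpen_ball.mem_nhds hyU)
    exact ⟨hd, (hball hyU).2 hd hyΩ⟩
  -- The segment from `y` itself may lie in the exceptional null set. Almost every parallel segment
  -- is good, and the desired inequality is closed in the base point, so density suffices.
  have hdense := Measure.dense_of_ae (ae_ae_add_smul_of_ae hae η)
  intro y hy t ht hyt
  have hopen : IsOpen (U ∩ (fun z => z + t • η) ⁻¹' U) :=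
    Metric.isOpen_ball.inter (Metric.isOpen_ball.preimage (by fun_prop))
  have hcont := hB.continuous
  have hclosed : IsClosed {z : E | B (z + t • η) - B z ≤ c * t} :=
    isClosed_le (by fun_prop) continuous_const
  refine hclosed.closure_subset_iff.2 ?_ (hdense.open_subset_closure_inter hopen ⟨hy, hyt⟩)
  rintro z ⟨⟨hz, hzt⟩, hgood⟩
  have hseg : ∀ s ∈ Icc 0 t, z + s • η ∈ U := by
    intro s hs
    rcases ht.eq_or_lt with rfl | htpos
    · obtain rfl : s = 0 := le_antisymm hs.2 hs.1
      simpa using hz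
    · have := (convex_ball p r).add_smul_mem hz hzt
        (t := s / t) ⟨div_nonneg hs.1 ht, div_le_one_of_le₀ hs.2 ht⟩
      rwa [smul_smul, div_mul_cancel₀ _ htpos.ne'] at this
  have hline : LipschitzWith ‖η‖₊ fun s : ℝ => z + s • η := by
    refine LipschitzWith.of_dist_le_mul fun a b => ?_
    rw [dist_add_left, dist_eq_norm, ← sub_smul, norm_smul, mul_comm, dist_eq_norm, coe_nnnorm]
  have hlip : LipschitzOnWith (L * ‖η‖₊) (fun s : ℝ => B (z + s • η)) (uIcc 0 t) := by
    rw [uIcc_of_le ht]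
    exact hLU.comp hline.lipschitzOnWith hseg
  have := hlip.absolutelyContinuousOnInterval.sub_le_of_ae_deriv_le (c := c) ht (by
    filter_upwards [hgood] with s hs hst
    obtain ⟨hd, hlt⟩ := hs (hseg s (Ioo_subset_Icc_self hst))
    have h1 : HasDerivAt (fun s : ℝ => z + s • η) η s := by
      simpa using ((hasDerivAt_id s).smul_const η).const_add z
    have h2 := hd.hasFDerivAt.comp_hasDerivAt s h1
    have h3 : deriv (fun s : ℝ => B (z + s • η)) s = inner ℝ (gradient B (z + s • η)) η := by
      rw [← InnerProductSpace.toDual_apply_apply, toDual_gradient]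
      exact h2.deriv
    rw [h3]
    exact hlt.le)
  simpa using this

/-- If all Clarke gradients at `p` decrease in the direction `η`, then `B` decreases along every
sequence that leaves `p` in the direction `η`. -/
theorem eventually_lt_of_clarkeGradient_neg {B : E → ℝ} (hB : LocallyLipschitz B) {Ω : Set E}
    (hΩ : volume Ω = 0) {p η : E} {m : ℝ} (hm : m < 0)
    (h : ∀ ζ ∈ clarkeGradient Ω B p, inner ℝ ζ η ≤ m) {t : ℕ → ℝ} {v : ℕ → E}
    (ht : Tendsto t atTop (𝓝[>] 0)) (hv : Tendsto v atTop (𝓝 η)) :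
    ∀ᶠ k in atTop, B (p + t k • v k) < B p := by
  obtain ⟨L, s, hs, hL⟩ := hB p
  -- Moving along `η` gains at least `-m / 2` per unit time; replacing `η` by `v k` costs at most `L
  -- * ‖v k - η‖`, eventually less than that.
  obtain ⟨r, hr, hball⟩ := exists_ball_sub_le_of_clarkeGradient hB hΩ
    (fun ζ hζ => (h ζ hζ).trans_lt (by linarith : m < m / 2))
  have ht0 : Tendsto t atTop (𝓝 0) := ht.mono_right nhdsWithin_le_nhds
  have hlim : ∀ w : ℕ → E, Tendsto w atTop (𝓝 η) →
      Tendsto (fun k => p + t k • w k) atTop (𝓝 p) := by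
    intro w hw
    simpa using tendsto_const_nhds.add (ht0.smul hw)
  have hsmall : ∀ᶠ k in atTop, L * ‖v k - η‖ < -m / 2 := by
    have : Tendsto (fun k => L * ‖v k - η‖) atTop (𝓝 0) := by
      simpa using ((hv.sub_const η).norm.const_mul (L : ℝ))
    exact this.eventually_lt_const (by linarith)
  filter_upwards [hsmall, ht.eventually self_mem_nhdsWithin, (hlim v hv).eventually hs,
    (hlim _ tendsto_const_nhds).eventually hs,
    (hlim _ tendsto_const_nhds).eventually (Metric.ball_mem_nhds p hr)] with k h1 h2 h3 h4 h5
  have h6 := hball p (Metric.mem_ball_self hr) (t k) (le_of_lt h2) h5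
  have h7 := (le_abs_self _).trans (hL.norm_sub_le h3 h4)
  have h8 : p + t k • v k - (p + t k • η) = t k • (v k - η) := by rw [smul_sub]; abel
  rw [h8, norm_smul, Real.norm_of_nonneg (le_of_lt h2)] at h7
  have h9 : t k * (L * ‖v k - η‖) < t k * (-m / 2) := mul_lt_mul_of_pos_left h1 h2
  linarith [mul_left_comm (L : ℝ) (t k) ‖v k - η‖, mul_comm (m / 2) (t k),
    mul_comm (-m / 2) (t k)]

/-- Limits of difference quotients of sequences in `S` are in the contingent cone. -/
theorem mem_contingentCone_of_tendsto {S : Set E} {p η : E} {t : ℕ → ℝ} {v : ℕ → E}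
    (ht : Tendsto t atTop (𝓝[>] 0)) (hv : Tendsto v atTop (𝓝 η))
    (hS : ∀ᶠ k in atTop, p + t k • v k ∈ S) : η ∈ contingentCone S p := by
  refine le_antisymm (le_of_forall_gt fun ε hε => ?_) zero_le
  obtain ⟨ε', hε', hlt⟩ := exists_between hε
  refine lt_of_le_of_lt (liminf_le_of_frequently_le' ?_) hlt
  refine ht.frequently (Eventually.frequently ?_)
  have hed : Tendsto (fun k => edist η (v k)) atTop (𝓝 0) := by
    simpa using (tendsto_const_nhds (x := η)).edist hv
  filter_upwards [hS, ht.eventually self_mem_nhdsWithin, hed.eventually_lt_const hε']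
    with k hk htk hek
  -- The point `p + t k • v k` of `S` is at distance `t k * ‖η - v k‖` from `p + t k • η`.
  refine ENNReal.div_le_of_le_mul ?_
  refine (Metric.infEDist_le_edist_of_mem hk).trans ?_
  rw [edist_add_left, edist_dist, dist_eq_norm, ← smul_sub, norm_smul,
    Real.norm_of_nonneg (le_of_lt htk), ENNReal.ofReal_mul (le_of_lt htk), mul_comm,
    ← dist_eq_norm, ← edist_dist]
  gcongr

end Clarke

/-- Translating the variable preserves absolute continuity. -/
theorem AbsolutelyContinuousOnInterval.comp_const_add {X : Type*} [PseudoMetricSpace X]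
    {f : ℝ → X} {a b c : ℝ} (hf : AbsolutelyContinuousOnInterval f (c + a) (c + b)) :
    AbsolutelyContinuousOnInterval (fun t => f (c + t)) a b := by
  rw [absolutelyContinuousOnInterval_iff] at hf ⊢
  intro ε hε
  obtain ⟨δ, hδ, h⟩ := hf ε hε
  refine ⟨δ, hδ, fun P hP hlen => ?_⟩
  refine h (P.1, fun i => (c + (P.2 i).1, c + (P.2 i).2)) ⟨fun i hi => ?_, ?_⟩ (by simpa using hlen)
  · have := hP.1 i hi
    simp only [mem_uIcc, add_le_add_iff_left] at this ⊢
    exact this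
  · intro i hi k hk hik
    have hdisj : Disjoint (uIoc (P.2 i).1 (P.2 i).2) (uIoc (P.2 k).1 (P.2 k).2) := hP.2 hi hk hik
    refine Set.disjoint_left.2 fun z hz hz' => ?_
    have hsep : z - c ∈ uIoc (P.2 i).1 (P.2 i).2 → z - c ∉ uIoc (P.2 k).1 (P.2 k).2 :=
      fun h => Set.disjoint_left.1 hdisj h
    refine hsep ?_ ?_
    · simp only [mem_uIoc] at hz ⊢
      exact hz.imp (fun h => ⟨by linarith [h.1], by linarith [h.2]⟩)
        fun h => ⟨by linarith [h.1], by linarith [h.2]⟩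
    · simp only [mem_uIoc] at hz' ⊢
      exact hz'.imp (fun h => ⟨by linarith [h.1], by linarith [h.2]⟩)
        fun h => ⟨by linarith [h.1], by linarith [h.2]⟩

namespace HybridSystem

variable {n : ℕ}

local notation "E" => EuclideanSpace ℝ (Fin n)

/-! ### The flow map -/

/-- The flow map has compact values. -/
theorem StandingAssumptions.isCompact {H : HybridSystem n} (hH : H.StandingAssumptions) {p : E}
    (hp : p ∈ H.C) : IsCompact (H.F p) := by
  obtain ⟨U, hU, M, hM⟩ := hH.locallyBounded p hp
  refine Metric.isCompact_of_isClosed_isBounded ?_ ?_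
  · refine isClosed_of_closure_subset fun η hη => ?_
    obtain ⟨y, hy, hlim⟩ := mem_closure_iff_seq_limit.1 hη
    exact hH.outerSemicontinuous p hp (fun _ => p) y η (fun _ => hp) hy tendsto_const_nhds hlim
  · exact isBounded_iff_forall_norm_le.2 ⟨M, hM p ⟨mem_of_mem_nhds hU, hp⟩⟩

/-- The flow map is upper semicontinuous. -/
theorem StandingAssumptions.eventually_subset_cthickening {H : HybridSystem n}
    (hH : H.StandingAssumptions) {p : E} (hp : p ∈ H.C) {ε : ℝ} (hε : 0 < ε) :
    ∀ᶠ q in 𝓝 p, q ∈ H.C → H.F q ⊆ Metric.cthickening ε (H.F p) := by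
  by_contra hn
  obtain ⟨u, hu, hun⟩ := exists_seq_forall_of_frequently (not_eventually.1 hn)
  push Not at hun
  choose huC hsub using hun
  choose y hyF hy using fun k => Set.not_subset.1 (hsub k)
  obtain ⟨U, hU, M, hM⟩ := hH.locallyBounded p hp
  have hb : ∀ᶠ k in atTop, y k ∈ Metric.closedBall (0 : E) M := by
    filter_upwards [hu.eventually hU] with k hk
    exact mem_closedBall_zero_iff.2 (hM (u k) ⟨hk, huC k⟩ _ (hyF k))
  obtain ⟨η, -, φ, hφ, hlim⟩ := (isCompact_closedBall (0 : E) M).tendsto_subseq' hb.frequently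
  have hη := hH.outerSemicontinuous p hp (u ∘ φ) (y ∘ φ) η (fun k => huC _) (fun k => hyF _)
    (hu.comp hφ.tendsto_atTop) hlim
  obtain ⟨k, hk⟩ := (hlim.eventually (Metric.isOpen_thickening.mem_nhds
    (Metric.self_subset_thickening hε _ hη))).exists
  exact hy _ (Metric.thickening_subset_cthickening _ _ hk)

/-! ### Flow arcs -/

/-- `γ` is a solution of the constrained differential inclusion `ẋ ∈ F(x)`, `x ∈ C` on `[a, b]`. -/
structure IsFlowArc (H : HybridSystem n) (γ : ℝ → E) (a b : ℝ) : Prop where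
  lt : a < b
  absolutelyContinuous : AbsolutelyContinuousOnInterval γ a b
  mem : ∀ t ∈ Ioo a b, γ t ∈ H.C
  deriv : ∀ᵐ t, t ∈ Ioo a b → ∃ v ∈ H.F (γ t), HasDerivAt γ v t

namespace IsFlowArc

variable {H : HybridSystem n} {γ : ℝ → EuclideanSpace ℝ (Fin n)} {a b : ℝ}

theorem mono (h : H.IsFlowArc γ a b) {c d : ℝ} (hcd : c < d) (hac : a ≤ c) (hdb : d ≤ b) :
    H.IsFlowArc γ c d where
  lt := hcd
  absolutelyContinuous := h.absolutelyContinuous.mono (by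
    rw [uIcc_of_le hcd.le, uIcc_of_le h.lt.le]; exact Icc_subset_Icc hac hdb)
  mem t ht := h.mem t (Ioo_subset_Ioo hac hdb ht)
  deriv := h.deriv.mono fun t ht hmem => ht (Ioo_subset_Ioo hac hdb hmem)

theorem continuousOn (h : H.IsFlowArc γ a b) : ContinuousOn γ (Icc a b) :=
  uIcc_of_le h.lt.le ▸ h.absolutelyContinuous.continuousOn

theorem tendsto_right (h : H.IsFlowArc γ a b) : Tendsto γ (𝓝[>] a) (𝓝 (γ a)) := by
  have := (h.continuousOn a (left_mem_Icc.2 h.lt.le)).mono Ioo_subset_Icc_self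
  rwa [ContinuousWithinAt, nhdsWithin_Ioo_eq_nhdsGT h.lt] at this

theorem eventually_mem (h : H.IsFlowArc γ a b) : ∀ᶠ t in 𝓝[>] a, γ t ∈ H.C := by
  filter_upwards [Ioo_mem_nhdsGT h.lt] with t ht using h.mem t ht

/-- The initial point of a flow arc is one from which a solution can flow. -/
theorem canFlowFrom (h : H.IsFlowArc γ a b) : H.CanFlowFrom (γ a) := by
  have hint : ({t : ℝ | (t, 0) ∈ Icc 0 (b - a) ×ˢ ({0} : Set ℕ)} : Set ℝ) = Icc 0 (b - a) := by
    ext t; simp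
  have hshift : ∀ t ∈ Ioo 0 (b - a), a + t ∈ Ioo a b := fun t ht =>
    ⟨by linarith [ht.1], by linarith [ht.2]⟩
  -- The arc is restarted at time `0`, with no jumps.
  refine ⟨⟨Icc 0 (b - a) ×ˢ {0}, fun t _ => γ (a + t)⟩, ?_, by simp, b - a, sub_pos.2 h.lt,
    ⟨⟨(sub_pos.2 h.lt).le, le_rfl⟩, rfl⟩⟩
  constructor
  · refine ⟨⟨(0, 0), ⟨⟨le_rfl, (sub_pos.2 h.lt).le⟩, rfl⟩⟩, fun p hp => hp.1.1, ?_⟩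
    rintro T J ⟨hT, hJ⟩
    obtain rfl : J = 0 := hJ
    refine ⟨fun k => if k = 0 then 0 else T, by simp, by simpa using hT.1, ?_⟩
    ext ⟨t, j⟩
    simp only [mem_inter_iff, mem_prod, mem_Icc, mem_singleton_iff, mem_Iic, mem_iUnion] at hT ⊢
    constructor
    · rintro ⟨⟨ht, rfl⟩, ht', -⟩
      exact ⟨0, le_rfl, by simpa using ht', rfl⟩
    · rintro ⟨i, hi, ht, rfl⟩
      obtain rfl : j = 0 := by omega
      simp only [if_true, zero_add, one_ne_zero, if_false] at ht
      exact ⟨⟨⟨ht.1, ht.2.trans hT.2⟩, rfl⟩, ht, le_rfl⟩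
  · rintro j c ⟨hc, -⟩ d ⟨hd, -⟩
    refine AbsolutelyContinuousOnInterval.comp_const_add (h.absolutelyContinuous.mono ?_)
    rw [uIcc_of_le h.lt.le]
    refine uIcc_subset_Icc ?_ ?_
    · exact ⟨by linarith [hc.1], by linarith [hc.2]⟩
    · exact ⟨by linarith [hd.1], by linarith [hd.2]⟩
  -- Only `closure H.C` is reached here: `γ a` is a limit of points of `C` and need not belong to
  -- `C`.
  · left
    simpa using mem_closure_of_tendsto h.tendsto_right h.eventually_mem
  · intro j hj t ht
    rw [HybridArc.interval] at hj ht
    rcases eq_or_ne j 0 with rfl | h0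
    · rw [hint, interior_Icc] at ht
      exact h.mem _ (hshift t ht)
    · simp [h0] at hj
  · intro j hj
    rw [HybridArc.interval] at hj ⊢
    rcases eq_or_ne j 0 with rfl | h0
    · rw [hint, ← restrict_Ioo_eq_restrict_Icc, ae_restrict_iff' measurableSet_Ioo]
      filter_upwards [(measurePreserving_add_left volume a).quasiMeasurePreserving.ae h.deriv]
        with t ht hmem
      obtain ⟨v, hv, hd⟩ := ht (hshift t hmem)
      exact ⟨v, hv, hd.comp_const_add a t⟩
    · simp [h0] at hj
  · rintro t j - ⟨-, hj⟩
    exact absurd hj (Nat.succ_ne_zero j)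

/-- The difference quotients at the start of a flow arc approach the value of the flow map. -/
theorem eventually_slope_mem (h : H.IsFlowArc γ a b) (hH : H.StandingAssumptions)
    (ha : γ a ∈ H.C) {ε : ℝ} (hε : 0 < ε) :
    ∀ᶠ t in 𝓝[>] a, slope γ a t ∈ Metric.cthickening ε (H.F (γ a)) := by
  obtain ⟨c, hc, hsub⟩ := mem_nhdsGT_iff_exists_Ioo_subset.1
    (h.tendsto_right.eventually (hH.eventually_subset_cthickening ha hε))
  filter_upwards [Ioo_mem_nhdsGT hc, Ioo_mem_nhdsGT h.lt] with t htc htb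
  have hmono := h.mono htb.1 le_rfl htb.2.le
  refine hmono.absolutelyContinuous.slope_mem htb.1 ((hH.convex _ ha).cthickening ε)
    Metric.isClosed_cthickening ?_
  filter_upwards [hmono.deriv] with s hs hst
  obtain ⟨v, hv, hd⟩ := hs hst
  exact ⟨v, hsub ⟨hst.1, hst.2.trans htc.2⟩ (hmono.mem s hst) hv, hd⟩

/-- Along a subsequence, the difference quotients at the start of a flow arc converge to a velocity
in the flow map. -/
theorem exists_tendsto_slope (h : H.IsFlowArc γ a b) (hH : H.StandingAssumptions)
    (ha : γ a ∈ H.C) {t : ℕ → ℝ} (ht : Tendsto t atTop (𝓝[>] a)) :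
    ∃ η ∈ H.F (γ a), ∃ φ : ℕ → ℕ, StrictMono φ ∧
      Tendsto (fun k => slope γ a (t (φ k))) atTop (𝓝 η) := by
  have hcomp : IsCompact (Metric.cthickening 1 (H.F (γ a))) := (hH.isCompact ha).cthickening
  obtain ⟨η, -, φ, hφ, hlim⟩ := hcomp.tendsto_subseq'
    (ht.eventually (h.eventually_slope_mem hH ha one_pos)).frequently
  refine ⟨η, ?_, φ, hφ, hlim⟩
  -- A closed set is the intersection of its closed thickenings, each of which contains the limit.
  rw [← (hH.isCompact ha).isClosed.closure_eq, Metric.closure_eq_iInter_cthickening, mem_iInter₂]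
  intro ε hε
  exact Metric.isClosed_cthickening.mem_of_tendsto hlim ((ht.comp hφ.tendsto_atTop).eventually
    (h.eventually_slope_mem hH ha hε))

/-- If a flow arc visits `S` at arbitrarily small times, then it visits `S` along a sequence of
times whose difference quotients converge to a velocity in the flow map and in the contingent cones
of `S` and `C`. -/
theorem exists_mem_contingentCone (h : H.IsFlowArc γ a b) (hH : H.StandingAssumptions)
    (ha : γ a ∈ H.C) {S : Set E} (hS : ∃ᶠ t in 𝓝[>] a, γ t ∈ S) :
    ∃ η ∈ H.F (γ a), η ∈ contingentCone H.C (γ a) ∧ η ∈ contingentCone S (γ a) ∧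
      ∃ (s : ℕ → ℝ) (v : ℕ → E), Tendsto s atTop (𝓝[>] 0) ∧ Tendsto v atTop (𝓝 η) ∧
        ∀ k, γ a + s k • v k ∈ S := by
  obtain ⟨t, ht, htS⟩ := exists_seq_forall_of_frequently hS
  obtain ⟨η, hη, φ, hφ, hlim⟩ := h.exists_tendsto_slope hH ha ht
  have htφ := ht.comp hφ.tendsto_atTop
  have hs : Tendsto (fun k => t (φ k) - a) atTop (𝓝[>] 0) := by
    refine tendsto_nhdsWithin_iff.2 ⟨?_, ?_⟩
    · simpa using (htφ.mono_right nhdsWithin_le_nhds).sub_const a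
    · filter_upwards [htφ.eventually self_mem_nhdsWithin] with k hk
      exact sub_pos.2 hk
  have heq : ∀ k, γ a + (t (φ k) - a) • slope γ a (t (φ k)) = γ (t (φ k)) := fun k => by
    rw [sub_smul_slope, vsub_eq_sub, add_sub_cancel]
  have hmem : ∀ k, γ a + (t (φ k) - a) • slope γ a (t (φ k)) ∈ S := fun k => by
    rw [heq]; exact htS _
  refine ⟨η, hη, mem_contingentCone_of_tendsto hs hlim ?_,
    mem_contingentCone_of_tendsto hs hlim (Eventually.of_forall hmem), _, _, hs, hlim, hmem⟩
  filter_upwards [htφ.eventually h.eventually_mem] with k hk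
  rw [heq]
  exact hk

/-- The barrier function decreases initially along a flow arc. -/
theorem eventually_barrier_lt (h : H.IsFlowArc γ a b) (hH : H.StandingAssumptions)
    (ha : γ a ∈ H.C) {B : E → ℝ} (hB : LocallyLipschitz B) {Ω : Set E} (hΩ : volume Ω = 0)
    (hflow : ∀ η ∈ H.F (γ a) ∩ contingentCone H.C (γ a),
      ∃ m : ℝ, IsGreatest ((fun ζ => inner ℝ ζ η) '' clarkeGradient Ω B (γ a)) m ∧ m < 0) :
    ∀ᶠ t in 𝓝[>] a, B (γ t) < B (γ a) := by
  by_contra hn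
  obtain ⟨η, hη, hηC, -, s, v, hs, hv, hmem⟩ :=
    h.exists_mem_contingentCone hH ha (S := {q | ¬B q < B (γ a)}) (not_eventually.1 hn)
  obtain ⟨m, hm, hm0⟩ := hflow η ⟨hη, hηC⟩
  obtain ⟨k, hk⟩ := (eventually_lt_of_clarkeGradient_neg hB hΩ hm0
    (fun ζ hζ => hm.2 (mem_image_of_mem _ hζ)) hs hv).exists
  exact hmem k hk

/-- A flow arc starting in the barrier set enters its interior. -/
theorem eventually_mem_interior (h : H.IsFlowArc γ a b) (hH : H.StandingAssumptions)
    (ha : γ a ∈ H.C) {B : E → ℝ} (hB : LocallyLipschitz B) (haB : B (γ a) ≤ 0)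
    (hlt : ∀ᶠ t in 𝓝[>] a, B (γ t) < B (γ a))
    (hboundary : ∀ p ∈ frontier (H.barrierSet B) ∩ frontier H.C,
      H.F p ∩ contingentCone (frontier H.C ∩ frontier (H.barrierSet B)) p = ∅) :
    ∀ᶠ t in 𝓝[>] a, γ t ∈ interior (H.barrierSet B) := by
  by_contra hn
  -- Where `B < 0`, an interior point of `C` is interior to `K`; so a point of the arc outside `int
  -- K` lies on both frontiers.
  have hfreq : ∃ᶠ t in 𝓝[>] a, γ t ∈ frontier H.C ∩ frontier (H.barrierSet B) := by
    refine ((not_eventually.1 hn).and_eventually (hlt.and h.eventually_mem)).mono ?_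
    rintro t ⟨hnot, hBt, hC⟩
    have hK : γ t ∈ H.barrierSet B := ⟨Or.inl hC, (hBt.trans_le haB).le⟩
    refine ⟨⟨subset_closure hC, fun hint => hnot ?_⟩, subset_closure hK, hnot⟩
    refine mem_interior_iff_mem_nhds.2 ?_
    filter_upwards [mem_interior_iff_mem_nhds.1 hint,
      hB.continuous.continuousAt.eventually_lt_const (hBt.trans_le haB)] with q hq hqB
    exact ⟨Or.inl hq, hqB.le⟩
  have hmem := (isClosed_frontier.inter isClosed_frontier).mem_of_frequently_of_tendsto hfreq
    h.tendsto_right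
  obtain ⟨η, hη, -, hηS, -⟩ := h.exists_mem_contingentCone hH ha hfreq
  exact (hboundary _ hmem.symm).le ⟨hη, hηS⟩

/-- Flow arcs do not leave a closed barrier set. -/
theorem mem_barrierSet (h : H.IsFlowArc γ a b) (hH : H.StandingAssumptions)
    {B : E → ℝ} (hB : LocallyLipschitz B) (hK : IsClosed (H.barrierSet B))
    (hstart : ∀ p ∈ frontier (H.barrierSet B), H.CanFlowFrom p → p ∈ H.C)
    {Ω : Set E} (hΩ : volume Ω = 0)
    (hflow : ∀ p ∈ {q | B q ≤ 0} ∩ H.C, ∀ η ∈ H.F p ∩ contingentCone H.C p,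
      ∃ m : ℝ, IsGreatest ((fun ζ => inner ℝ ζ η) '' clarkeGradient Ω B p) m ∧ m < 0)
    (ha : γ a ∈ H.barrierSet B) : γ b ∈ H.barrierSet B := by
  -- Continuous induction: the times spent in `K` form a closed set, and each such time before `b`
  -- is followed by others arbitrarily close.
  refine IsClosed.Icc_subset_of_forall_exists_gt (s := γ ⁻¹' H.barrierSet B) ?_ ha ?_
    (right_mem_Icc.2 h.lt.le)
  · rw [inter_comm]
    exact h.continuousOn.preimage_isClosed_of_isClosed isClosed_Icc hK
  · rintro t ⟨htK, ht⟩ y hy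
    have harc := h.mono ht.2 ht.1 le_rfl
    suffices hev : ∀ᶠ s in 𝓝[>] t, γ s ∈ H.barrierSet B by
      obtain ⟨s, hs, hsy⟩ := (hev.and (Ioc_mem_nhdsGT hy)).exists
      exact ⟨s, hs, hsy⟩
    by_cases hint : γ t ∈ interior (H.barrierSet B)
    · exact harc.tendsto_right.eventually (mem_interior_iff_mem_nhds.1 hint)
    -- The remainder of the arc is itself a flow from `γ t ∈ ∂K`, which forces `γ t ∈ C`.
    · have htC := hstart _ ⟨subset_closure htK, hint⟩ harc.canFlowFrom
      filter_upwards [harc.eventually_mem,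
        harc.eventually_barrier_lt hH htC hB hΩ (hflow _ ⟨htK.2, htC⟩)] with s hs hlt
      exact ⟨Or.inl hs, (hlt.trans_le htK.2).le⟩

end IsFlowArc

end HybridSystem

/-! ### Solutions between jumps -/

namespace HybridArc

variable {n : ℕ} {H : HybridSystem n} {x : HybridArc n}

/-- The time intervals of a solution are order connected. -/
theorem IsSolution.Icc_subset_interval (hx : x.IsSolution H) {j : ℕ} {a b : ℝ}
    (ha : a ∈ x.interval j) (hb : b ∈ x.interval j) : Icc a b ⊆ x.interval j := by
  intro s hs
  obtain ⟨-, hnonneg, hdom⟩ := hx.hybridTimeDomain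
  obtain ⟨t, -, -, ht⟩ := hdom b j hb
  have hmem : ∀ r, (r, j) ∈ x.dom ∧ 0 ≤ r ∧ r ≤ b ↔ t j ≤ r ∧ r ≤ t (j + 1) := by
    intro r
    have := Set.ext_iff.1 ht (r, j)
    simpa using this
  have h1 := (hmem a).1 ⟨ha, hnonneg _ ha, hs.1.trans hs.2⟩
  have h2 := (hmem b).1 ⟨hb, hnonneg _ hb, le_rfl⟩
  exact ((hmem s).2 ⟨h1.1.trans hs.1, hs.2.trans h2.2⟩).1

/-- The restriction of a solution to a compact interval between jumps is a flow arc. -/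
theorem IsSolution.isFlowArc (hx : x.IsSolution H) {j : ℕ} {a b : ℝ} (hab : a < b)
    (ha : a ∈ x.interval j) (hb : b ∈ x.interval j) :
    H.IsFlowArc (fun t => x.toFun t j) a b := by
  have hsub := hx.Icc_subset_interval ha hb
  have hint : Ioo a b ⊆ interior (x.interval j) :=
    interior_maximal (Ioo_subset_Icc_self.trans hsub) isOpen_Ioo
  have hne : (interior (x.interval j)).Nonempty := (nonempty_Ioo.2 hab).mono hint
  refine ⟨hab, hx.absolutelyContinuous j a ha b hb, fun t ht => hx.flow_mem j hne t (hint ht), ?_⟩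
  rw [← ae_restrict_iff' measurableSet_Ioo]
  exact ae_restrict_of_ae_restrict_of_subset (Ioo_subset_Icc_self.trans hsub) (hx.flow j hne)

end HybridArc

/-! ### Pre-contractivity -/

theorem theorem6 {n : ℕ} (H : HybridSystem n) (hH : H.StandingAssumptions)
    (B : EuclideanSpace ℝ (Fin n) → ℝ) (hB : LocallyLipschitz B)
    (K : Set (EuclideanSpace ℝ (Fin n))) (hK : K = H.barrierSet B) (hKclosed : IsClosed K)
    -- flows out of the boundary of `K` start in the flow set (automatic if `C` is closed)
    (hstart : ∀ p ∈ frontier K, H.CanFlowFrom p → p ∈ H.C)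
    -- the null set used in the definition of the Clarke generalized gradient
    (Ω : Set (EuclideanSpace ℝ (Fin n))) (hΩ : volume Ω = 0)
    -- `max_{ζ ∈ ∂_C B(p)} ⟨ζ, η⟩ < 0` on `K_e ∩ C`
    (hflow : ∀ p ∈ {q | B q ≤ 0} ∩ H.C, ∀ η ∈ H.F p ∩ contingentCone H.C p,
      ∃ m : ℝ, IsGreatest ((fun ζ => inner ℝ ζ η) '' clarkeGradient Ω B p) m ∧ m < 0)
    (hboundary : ∀ p ∈ frontier K ∩ frontier H.C,
      H.F p ∩ contingentCone (frontier H.C ∩ frontier K) p = ∅)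
    (hjump : ∀ p ∈ K ∩ H.D, ∀ η ∈ H.G p, B η < 0)
    (hjump_mem : ∀ p ∈ K ∩ H.D, H.G p ⊆ H.C ∪ H.D)
    (hjump_int : ∀ p ∈ frontier K ∩ H.D, H.G p ⊆ interior (H.C ∪ H.D)) :
    H.PreContractive K := by
  subst hK
  refine ⟨?_, ?_⟩
  · rintro x ⟨hx, -⟩ hx0 T J hTJ
    have hseg : ∀ j a b, a ≤ b → a ∈ x.interval j → b ∈ x.interval j →
        x.toFun a j ∈ H.barrierSet B → x.toFun b j ∈ H.barrierSet B := by
      intro j a b hab ha hb hmem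
      rcases hab.eq_or_lt with rfl | hlt
      · exact hmem
      · exact (hx.isFlowArc hlt ha hb).mem_barrierSet hH hB hKclosed hstart hΩ hflow hmem
    obtain ⟨t, ht0, htmono, ht⟩ := hx.hybridTimeDomain.2.2 T J hTJ
    have hdom : ∀ j ≤ J, ∀ s ∈ Icc (t j) (t (j + 1)), (s, j) ∈ x.dom := by
      intro j hj s hs
      have : (s, j) ∈ x.dom ∩ Icc 0 T ×ˢ Iic J := by
        rw [ht]
        exact mem_biUnion hj ⟨hs, rfl⟩
      exact this.1
    have hleft : ∀ j ≤ J, (t j, j) ∈ x.dom := fun j hj =>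
      hdom j hj _ ⟨le_rfl, htmono j hj⟩
    have hright : ∀ j ≤ J, (t (j + 1), j) ∈ x.dom := fun j hj =>
      hdom j hj _ ⟨htmono j hj, le_rfl⟩
    -- Induction on the number of jumps: `K` is preserved by the flow up to `t (j + 1)`, then by the
    -- jump there.
    have key : ∀ j ≤ J, x.toFun (t j) j ∈ H.barrierSet B := by
      intro j
      induction j with
      | zero => intro _; rwa [ht0]
      | succ j ih =>
        intro hj
        have hj' : j ≤ J := by omega
        have hmem := hseg j _ _ (htmono j hj') (hleft j hj') (hright j hj') (ih hj')
        obtain ⟨hD, hG⟩ := hx.jump _ j (hright j hj') (hleft (j + 1) hj)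
        exact ⟨hjump_mem _ ⟨hmem, hD⟩ hG, (hjump _ ⟨hmem, hD⟩ _ hG).le⟩
    have hT : (T, J) ∈ x.dom ∩ Icc 0 T ×ˢ Iic J :=
      ⟨hTJ, ⟨hx.hybridTimeDomain.2.1 _ hTJ, le_rfl⟩, (le_rfl : J ≤ J)⟩
    rw [ht] at hT
    simp only [mem_iUnion, mem_prod, mem_singleton_iff] at hT
    obtain ⟨j, -, hTj, rfl⟩ := hT
    exact hseg J _ _ hTj.1 (hleft J le_rfl) hTJ (key J le_rfl)
  · intro x hx _ hx0
    have hxK : x.toFun 0 0 ∈ H.barrierSet B := hKclosed.frontier_subset hx0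
    have hzero : (0 : ℝ) ∈ x.interval 0 := by
      obtain ⟨⟨⟨T, J⟩, hTJ⟩, -, hdom⟩ := hx.hybridTimeDomain
      obtain ⟨t, ht0, htmono, ht⟩ := hdom T J hTJ
      have : ((0 : ℝ), 0) ∈ x.dom ∩ Icc 0 T ×ˢ Iic J := by
        rw [ht]
        exact mem_biUnion (Nat.zero_le J) ⟨⟨ht0.le, ht0 ▸ htmono 0 (Nat.zero_le J)⟩, rfl⟩
      exact this.1
    have hT : ∃ T : ℝ, 0 < T ∧ ∀ t ∈ Ioc 0 T, (t, 0) ∈ x.dom →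
        x.toFun t 0 ∈ interior (H.barrierSet B) := by
      by_cases hpos : ∃ b : ℝ, 0 < b ∧ (b, 0) ∈ x.dom
      · obtain ⟨b, hb, hbdom⟩ := hpos
        have harc := hx.isFlowArc hb hzero hbdom
        have hC := hstart _ hx0 ⟨x, hx, rfl, b, hb, hbdom⟩
        have hlt := harc.eventually_barrier_lt hH hC hB hΩ (hflow _ ⟨hxK.2, hC⟩)
        obtain ⟨T, hT, hsub⟩ := mem_nhdsGT_iff_exists_Ioc_subset.1
          (harc.eventually_mem_interior hH hC hB hxK.2 hlt hboundary)
        exact ⟨T, hT, fun t ht _ => hsub ht⟩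
      · exact ⟨1, one_pos, fun t ht htdom => absurd ⟨t, ht.1, htdom⟩ hpos⟩
    obtain ⟨T, hTpos, hT⟩ := hT
    -- With `J = 1`, the only jump to check is the one from `x(0,0) ∈ ∂K` to `x(0,1)`; later jumps
    -- at time `0` start in `int K`, where `hjump_int` says nothing.
    refine ⟨T, hTpos, 1, le_rfl, fun t j htj hor hne => ?_⟩
    rcases hor with ⟨ht, rfl⟩ | ⟨rfl, hj⟩
    · refine hT t ⟨ht.1.lt_of_ne fun h0 => hne ?_, ht.2⟩ htj
      rw [← h0]
    · have hj1 : j ≤ 1 := by exact_mod_cast hj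
      obtain rfl : j = 1 := by
        rcases Nat.le_one_iff_eq_zero_or_eq_one.1 hj1 with rfl | rfl
        · exact absurd rfl hne
        · rfl
      obtain ⟨hD, hG⟩ := hx.jump 0 0 hzero htj
      refine mem_interior_iff_mem_nhds.2 ?_
      filter_upwards [mem_interior_iff_mem_nhds.1 (hjump_int _ ⟨hx0, hD⟩ hG),
        hB.continuous.continuousAt.eventually_lt_const (hjump _ ⟨hxK, hD⟩ _ hG)] with q hq hqB
      exact ⟨hq, hqB.le⟩
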